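/- **Setting.** Let $G=(X,A)$ be a finite simple graph with at least one edge, with set of arcs $A$ (each edge gives two arcs $e,\bar e$; $o(e),t(e)$ are origin and terminus). Let $(G,\rho,\tau)$ be a rotation system: $\rho$ permutes cyclically the arcs ending at each vertex, and $\tau:A\to\mathbb Z_2$ satisfies $\tau(\bar e)=\tau(e)$. The double covering $G^\tau$ has the vertices $X\times\mathbb Z_2$ and the arcs $g=(e,k)$, $e\in A$, $k\in\mathbb Z_2$, from $(o(e),k-\tau(e))$ to $(t(e),k)$; so $\bar g=(\bar e,k-\tau(e))$. Put $\tau(g)=\tau(e)$, and let $\tilde\rho(e,0)=(\rho(e),0)$, $\tilde\rho(e,1)=(\rho^{-1}(e),1)$. **Blow-up with hedgehog tails.** The blow-up has the arcs of $G^\tau$ as vertices, and for every arc $g$ of $G^\tau$ an island arc $\xi_g$ from $g$ to $\tilde\rho(g)$ and a bridge arc from $\bar g$ to $g$. Write $A_{br}$ for the set of bridge arcs and denote the bridge arc from $\bar g$ to $g$ again by $g$; thus $|A_{br}|=2|A|$. Every island arc $\xi_g$ is divided by a new vertex $x_g$ into an arc $\xi_g^-$ ending and an arc $\xi_g^+$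 starting at $x_g$, and a semi-infinite path (the tail of $g$) is attached at $x_g$. **Walk.** Let $C=\begin{bmatrix}a&b\\c&d\end{bmatrix}$ be a unitary matrix with $d\in\mathbb R$ and $b\neq0$, and put $\omega=-\det C$. At every vertex other than the interior vertices of the tails, if $\xi,\beta$ are the incoming island arc and the incoming bridge or tail arc, and $\xi',\beta'$ the outgoing ones, then $\Psi_{t+1}(\xi')=a\Psi_t(\xi)+b\Psi_t(\beta)$ and $\Psi_{t+1}(\beta')=(-1)^{\tau(\beta')}\left(c\Psi_t(\xi)+d\Psi_t(\beta)\right)$, where $\tau=0$ on the tails; along the tails the amplitudes are just shifted by one arc per step. For $e\in A_{br}$ let $\Psi^{(e)}_t$ be the walk whose initial state is $1$ on all arcs of the tail of $e$ that are directed to $x_e$, and $0$ elsewhere. **Faces.** Facial walks of $G^\tau$ are the cycles of the permutation $g\mapsto\overline{\tilde\rho(g)}$. The set $F$ of faces of $(G,\rho,\tau)$ consists of the facial walks of $G^\tau$, where each one is identified with its reverse on the opposite sheet (its image under $(e,k)\mapsto(\bar e,k-\tau(e)+1)$). So every $f\in F$ is represented by two facial walks of $G^\tau$; $|f|$ is their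 common length. For $f\in F$ let $f\cap\bar f$ be the set of all $e\in A_{br}$ such that $e$ and $\bar e$ both lie on the same one of these two walks (every self-intersection of $f$ is thus seen on both sheets). If $e,e'$ lie on the same facial walk, $\mathrm{dist}_f(e,e')\ge0$ is the number of steps from $e'$ to $e$ along it. **Theorem.** For every $e\in A_{br}$ the limit $\psi^{(e)}=\lim_{t\to\infty}\Psi_t^{(e)}$ exists on every arc. Let $\mathcal E^{(e)}$ be half the sum of $|\psi^{(e)}|^2$ over all bridge arcs and all arcs $\xi_g^-,\xi_g^+$. Then the average $\mathbb E[\mathcal E]=\frac1{|A_{br}|}\sum_{e\in A_{br}}\mathcal E^{(e)}$ over a uniformly random tail is $$\mathbb E[\mathcal E]=\frac1{|A_{br}|}\frac{2+|b|^2}{|b|^2}\sum_{f\in F}|f|\frac{1-|a|^{2|f|}}{|1-(a\omega)^{|f|}|^2} +\frac1{|A_{br}|}\frac{d}{|b|^2}\sum_{f\in F}\frac1{|1-(a\omega)^{|f|}|^2}\sum_{e\in f\cap\bar f}\Big\{(a\omega)^{\mathrm{dist}_f(\bar e,e)}\big(1-|a|^{2\,\mathrm{dist}_f(e,\bar e)}\big)+(\overline{a\omega})^{\mathrm{dist}_f(e,\bar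 e)}\big(1-|a|^{2\,\mathrm{dist}_f(\bar e,e)}\big)\Big\}.$$ -/

import Mathlib

/-- A rotation system on a simple graph `G`: arcs are the darts of `G`, with origin `e.fst`,
terminus `e.snd` and inverse `e.symm`. The rotation permutes cyclically the arcs ending at each
vertex, and the twist gives a type in `ℤ/2` to each unoriented edge. -/
structure RotationSystem {V : Type*} (G : SimpleGraph V) where
  /-- the rotation `ρ` -/
  rot : Equiv.Perm G.Dart
  /-- `ρ` is a single cycle on the set of arcs with terminus `x`, for every vertex `x` -/
  rot_isCycleOn : ∀ x : V, rot.IsCycleOn {e : G.Dart | e.snd = x}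
  /-- the twist `τ` -/
  twist : G.Dart → ZMod 2
  twist_symm : ∀ e : G.Dart, twist e.symm = twist e

/-- The arcs of the double covering graph `G^τ`, whose vertex set is `V × ℤ/2`. The pair `(e, k)`
is the lift of the arc `e` whose terminus is `(e.snd, k)`; its origin is then
`(e.fst, k - τ e)`. -/
abbrev CoverArc {V : Type*} (G : SimpleGraph V) : Type _ := G.Dart × ZMod 2

namespace RotationSystem

variable {V : Type*} {G : SimpleGraph V}

/-- The inverse arc in the double covering graph. -/
def coverInv (R : RotationSystem G) : Equiv.Perm (CoverArc G) where
  toFun g := (g.1.symm, g.2 - R.twist g.1)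
  invFun g := (g.1.symm, g.2 - R.twist g.1)
  left_inv g := by
    have h : ∀ k t : ZMod 2, k - t - t = k := by decide
    simp [R.twist_symm, h]
  right_inv g := by
    have h : ∀ k t : ZMod 2, k - t - t = k := by decide
    simp [R.twist_symm, h]

/-- The rotation `ρ ⊕ ρ⁻¹` of the double covering graph: `ρ` on the front sheet `0`, and `ρ⁻¹` on
the back sheet `1`. -/
def coverRot (R : RotationSystem G) : Equiv.Perm (CoverArc G) where
  toFun g := ((if g.2 = 0 then R.rot else R.rot⁻¹) g.1, g.2)
  invFun g := ((if g.2 = 0 then R.rot⁻¹ else R.rot) g.1, g.2)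
  left_inv g := by
    by_cases h : g.2 = 0 <;> ext <;> simp [h]
  right_inv g := by
    by_cases h : g.2 = 0 <;> ext <;> simp [h]

/-- The facial walks of the double covering: after the arc `g`, turn by the rotation at the
terminus of `g` and leave along the inverse of the arc reached. In terms of `G`: after `e` comes
the inverse of `ρ e` or of `ρ⁻¹ e`, according to the sheet on which `e` arrives, that is, to the
sum of the twists passed so far. -/
def facial (R : RotationSystem G) : Equiv.Perm (CoverArc G) :=
  R.coverInv * R.coverRot

/-- The same arc, traversed in the opposite direction on the opposite sheet. -/
def chiral (R : RotationSystem G) : Equiv.Perm (CoverArc G) where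
  toFun g := (g.1.symm, g.2 - R.twist g.1 + 1)
  invFun g := (g.1.symm, g.2 - R.twist g.1 + 1)
  left_inv g := by
    have h : ∀ k t : ZMod 2, k - t + 1 - t + 1 = k := by decide
    simp [R.twist_symm, h]
  right_inv g := by
    have h : ∀ k t : ZMod 2, k - t + 1 - t + 1 = k := by decide
    simp [R.twist_symm, h]

theorem chiral_chiral (R : RotationSystem G) (g : CoverArc G) :
    R.chiral (R.chiral g) = g :=
  R.chiral.left_inv g

/-- Passing to the opposite direction on the opposite sheet reverses the facial walks. -/
theorem facial_chiral_facial (R : RotationSystem G) (g : CoverArc G) :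
    R.facial (R.chiral (R.facial g)) = R.chiral g := by
  obtain ⟨e, k⟩ := g
  have h2 : ∀ t : ZMod 2, 1 - t - t + 1 = 0 := by decide
  have h3 : ∀ t : ZMod 2, 1 - t + 1 = -t := by decide
  have h4 : ∀ t : ZMod 2, 1 - t = -t + 1 := by decide
  have hk : k = 0 ∨ k = 1 := by revert k; decide
  rcases hk with rfl | rfl
  · simp [facial, coverInv, coverRot, chiral, R.twist_symm, h4]
  · simp [facial, coverInv, coverRot, chiral, R.twist_symm, h2, h3]

theorem chiral_conj (R : RotationSystem G) :
    R.chiral * R.facial * R.chiral⁻¹ = R.facial⁻¹ := by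
  have hinv : R.chiral⁻¹ = R.chiral := rfl
  rw [hinv, eq_inv_iff_mul_eq_one]
  ext1 g
  have h := congrArg R.chiral (R.facial_chiral_facial g)
  rw [chiral_chiral] at h
  simpa only [Equiv.Perm.mul_apply, Equiv.Perm.one_apply] using h

theorem sameCycle_chiral (R : RotationSystem G) {g h : CoverArc G}
    (H : R.facial.SameCycle g h) : R.facial.SameCycle (R.chiral g) (R.chiral h) := by
  have := H.conj (g := R.chiral)
  rwa [chiral_conj, Equiv.Perm.sameCycle_inv] at this

/-- Two arcs of the double covering belong to the same face of the rotation system if they lie on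
the same facial walk of the double covering, or on facial walks which are the reverse of each other
on opposite sheets. -/
def faceSetoid (R : RotationSystem G) : Setoid (CoverArc G) where
  r g h := R.facial.SameCycle g h ∨ R.facial.SameCycle g (R.chiral h)
  iseqv :=
    { refl := fun g => Or.inl (Equiv.Perm.SameCycle.refl _ g)
      symm := by
        rintro g h (H | H)
        · exact Or.inl H.symm
        · refine Or.inr ?_
          have := R.sameCycle_chiral H
          rw [chiral_chiral] at this
          exact this.symm
      trans := by
        rintro g h k (H | H) (K | K)
        · exact Or.inl (H.trans K)
        · exact Or.inr (H.trans K)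
        · exact Or.inr (H.trans (R.sameCycle_chiral K))
        · refine Or.inl (H.trans ?_)
          have := R.sameCycle_chiral K
          rwa [chiral_chiral] at this }

/-- The set `F` of faces of the rotation system: facial walks up to cyclic shift and reversal. -/
def Face (R : RotationSystem G) : Type _ := Quotient R.faceSetoid

noncomputable instance (R : RotationSystem G) [Fintype V] [DecidableRel G.Adj] :
    Fintype R.Face :=
  haveI : DecidableEq V := Classical.decEq V
  haveI : Finite R.Face := inferInstanceAs (Finite (Quotient R.faceSetoid))
  Fintype.ofFinite _

/-- The face that contains an arc of the double covering. -/
def faceOf (R : RotationSystem G) (g : CoverArc G) : R.Face :=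
  Quotient.mk R.faceSetoid g

theorem isPeriodicPt_facial_iff (R : RotationSystem G) (n : ℕ) (g : CoverArc G) :
    Function.IsPeriodicPt R.facial n g ↔ (R.facial ^ n) g = g := by
  rw [Function.IsPeriodicPt, Function.IsFixedPt, Equiv.Perm.iterate_eq_pow]

theorem minimalPeriod_of_sameCycle (R : RotationSystem G) {g h : CoverArc G}
    (H : R.facial.SameCycle g h) :
    Function.minimalPeriod R.facial g = Function.minimalPeriod R.facial h := by
  rw [Function.minimalPeriod_eq_minimalPeriod_iff]
  intro n
  obtain ⟨i, rfl⟩ := H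
  rw [isPeriodicPt_facial_iff, isPeriodicPt_facial_iff, ← Equiv.Perm.mul_apply,
    ((Commute.refl R.facial).pow_left n).zpow_right i |>.eq, Equiv.Perm.mul_apply,
    EmbeddingLike.apply_eq_iff_eq]

theorem minimalPeriod_chiral (R : RotationSystem G) (g : CoverArc G) :
    Function.minimalPeriod R.facial (R.chiral g) = Function.minimalPeriod R.facial g := by
  rw [Function.minimalPeriod_eq_minimalPeriod_iff]
  intro n
  rw [isPeriodicPt_facial_iff, isPeriodicPt_facial_iff]
  have h : R.chiral * R.facial ^ n * R.chiral⁻¹ = (R.facial ^ n)⁻¹ := by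
    rw [← conj_pow, chiral_conj, inv_pow]
  have h' : (R.facial ^ n) (R.chiral g) = R.chiral g ↔
      (R.facial ^ n)⁻¹ (R.chiral g) = R.chiral g := by
    rw [Equiv.Perm.inv_eq_iff_eq, eq_comm]
  rw [h', ← h]
  have hinv : R.chiral⁻¹ = R.chiral := rfl
  rw [hinv, Equiv.Perm.mul_apply, Equiv.Perm.mul_apply, chiral_chiral,
    EmbeddingLike.apply_eq_iff_eq]

/-- The length `|f|` of a face: the length of its facial walk. -/
noncomputable def faceLength (R : RotationSystem G) (f : R.Face) : ℕ :=
  Quotient.lift (s := R.faceSetoid) (fun g => Function.minimalPeriod R.facial g)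
    (by
      rintro g h (H | H)
      · exact R.minimalPeriod_of_sameCycle H
      · exact (R.minimalPeriod_of_sameCycle H).trans (R.minimalPeriod_chiral h)) f

open Classical in
/-- The self-intersections `f ∩ f̄` of a face: the arcs `e` of the double covering, lying on the
face `f`, such that one facial walk passes through both `e` and its inverse. -/
noncomputable def selfIntersections [Fintype V] [DecidableRel G.Adj] (R : RotationSystem G)
    (f : R.Face) : Finset (CoverArc G) :=
  Finset.univ.filter fun e => R.faceOf e = f ∧ R.facial.SameCycle e (R.coverInv e)

/-- `dist_f(e, e')`: the number of steps from `e'` to `e` along the facial walk that contains both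
(used only for arcs on a common facial walk). -/
noncomputable def walkDist (R : RotationSystem G) (e e' : CoverArc G) : ℕ :=
  sInf {n : ℕ | (R.facial ^ n) e' = e}

end RotationSystem

/-- The arcs of the blow-up of the double covering graph with a tail inserted in every island arc.
The vertices of the blow-up are the arcs `g` of the double covering. There are an island arc
from `g` to `ρ g`, for every `g`, and a bridge arc from `g⁻¹` to `g`, for every `g`. The island
arc from `g` to `ρ g` is divided into two quay arcs by a new vertex, the root of its tail. -/
inductive WalkArc {V : Type*} (G : SimpleGraph V)
  /-- the first half `ξ⁻` of the island arc `ξ` from `g` to `ρ g`, ending at the tail's root -/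
  | quayMinus (g : CoverArc G)
  /-- the second half `ξ⁺` of the island arc `ξ` from `g` to `ρ g`, starting at the tail's root -/
  | quayPlus (g : CoverArc G)
  /-- the bridge arc from `g⁻¹` to `g` -/
  | bridge (g : CoverArc G)
  /-- the arc number `j` of the tail of `ξ`, directed to the root (number `0` ends there) -/
  | tailIn (g : CoverArc G) (j : ℕ)
  /-- the arc number `j` of the tail of `ξ`, directed to infinity (number `0` starts at the root) -/
  | tailOut (g : CoverArc G) (j : ℕ)

namespace RotationSystem

variable {V : Type*} {G : SimpleGraph V}

/-- One step of the quantum walk with coin `C = !![a, b; c, d]`. At each vertex with incoming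
island arc `ξ`, incoming bridge (or tail) arc `β`, outgoing island arc `ξ'` and outgoing bridge
(or tail) arc `β'`, the new amplitudes are `a ψ(ξ) + b ψ(β)` on `ξ'` and
`(-1)^τ (c ψ(ξ) + d ψ(β))` on `β'`, with twist `τ = 0` on tails; the motion on tails is free. -/
def step (R : RotationSystem G) (C : Matrix (Fin 2) (Fin 2) ℂ) (ψ : WalkArc G → ℂ) :
    WalkArc G → ℂ
  | .quayMinus g => C 0 0 * ψ (.quayPlus (R.coverRot⁻¹ g)) + C 0 1 * ψ (.bridge g)
  | .quayPlus g => C 0 0 * ψ (.quayMinus g) + C 0 1 * ψ (.tailIn g 0)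
  | .bridge g => (-1) ^ (R.twist g.1).val *
      (C 1 0 * ψ (.quayPlus (R.coverRot⁻¹ (R.coverInv g))) + C 1 1 * ψ (.bridge (R.coverInv g)))
  | .tailIn g j => ψ (.tailIn g (j + 1))
  | .tailOut g 0 => C 1 0 * ψ (.quayMinus g) + C 1 1 * ψ (.tailIn g 0)
  | .tailOut g (j + 1) => ψ (.tailOut g j)

end RotationSystem

/-- The initial state with inflow `α`: the constant `α g` on all arcs of the tail labelled by `g`
that are directed to the root, and `0` elsewhere. -/
def initialState {V : Type*} {G : SimpleGraph V} (α : CoverArc G → ℂ) : WalkArc G → ℂ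
  | .tailIn g _ => α g
  | _ => 0

/-- `ψ` is the stationary state of the walk with inflow `α`: the limit of the state at time `t`, on
every arc, as `t → ∞`. -/
def RotationSystem.IsStationaryState {V : Type*} {G : SimpleGraph V} (R : RotationSystem G)
    (C : Matrix (Fin 2) (Fin 2) ℂ) (α : CoverArc G → ℂ) (ψ : WalkArc G → ℂ) : Prop :=
  ∀ x : WalkArc G,
    Filter.Tendsto (fun t : ℕ => (R.step C)^[t] (initialState α) x) Filter.atTop (nhds (ψ x))

/-- The comfortability: half of the squared norm of a state restricted to the internal graph, which
consists of the (quay) island arcs and the bridge arcs. -/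
noncomputable def comfortability {V : Type*} [Fintype V] [DecidableEq V] {G : SimpleGraph V}
    [DecidableRel G.Adj] (ψ : WalkArc G → ℂ) : ℝ :=
  1 / 2 * ∑ g : CoverArc G,
    (‖ψ (.quayMinus g)‖ ^ 2 + ‖ψ (.quayPlus g)‖ ^ 2 + ‖ψ (.bridge g)‖ ^ 2)

/-! Since `d` is real, unitarity gives `a = -ωd` and `bc + ωd² = ω`. In the stationary regime the
two ends of a bridge therefore cancel each other's reflections: whatever enters along an island
leaves on the far side, multiplied by `ω` and the twist sign, and so follows the facial permutation
`φ`. The twist signs form a coboundary of the sheet sign and can be gauged away. Only the tail roots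
remain. There the amplitude is multiplied by `a` and the inflow enters with weight `b`, so up to
signs the stationary state for the tail of `e` is `b` times column `e` of `(1 - zφ)⁻¹`, with `z =
aω`.

This state is the limit (`isStationaryState_of_step_eq`): its difference from the initial state has
no inflow, and such a state leaks its energy into the tails.

Averaging over `e` turns the energy into entries of `(1 - zφ)⁻¹((1 - zφ)⁻¹)*`. As `φ` is unitary and
`1 - |z|² = |b|²`, `sum_resolvent_mul_conj` expresses them by a Poisson kernel. Its diagonal depends
only on the face length. The cross terms `(ḡ, g)` come from the bridges, and vanish unless both arcs
lie on one facial walk. -/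

namespace Equiv.Perm

/-! ### Resolvent of a permutation and its Poisson kernel -/

section CycleDist

variable {α : Type*} (φ : Equiv.Perm α)

/-- The number of steps from `y` to `x` along the cycle of `φ` that contains both. -/
noncomputable def cycleDist (x y : α) : ℕ :=
  sInf {n : ℕ | (φ ^ n) y = x}

open Classical in
/-- The matrix of `(1 - z φ)⁻¹`, where `φ` acts on functions by permuting the basis. -/
noncomputable def resolvent (z : ℂ) (x y : α) : ℂ :=
  if φ.SameCycle y x then
    z ^ φ.cycleDist x y / (1 - z ^ Function.minimalPeriod φ y)
  else 0

variable {φ}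

theorem minimalPeriod_pos [Finite α] (x : α) : 0 < Function.minimalPeriod φ x :=
  Function.minimalPeriod_pos_of_mem_periodicPts
    (Function.Injective.mem_periodicPts φ.injective x)

theorem pow_minimalPeriod_apply (x : α) : (φ ^ Function.minimalPeriod φ x) x = x := by
  rw [← Equiv.Perm.iterate_eq_pow]
  exact Function.iterate_minimalPeriod

theorem cycleDist_eq {x y : α} {n : ℕ} (h : (φ ^ n) y = x)
    (hn : n < Function.minimalPeriod φ y) : φ.cycleDist x y = n := by
  have hle : φ.cycleDist x y ≤ n := Nat.sInf_le h
  have hmem : (φ ^ φ.cycleDist x y) y = x := Nat.sInf_mem (s := {n : ℕ | (φ ^ n) y = x}) ⟨n, h⟩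
  refine Function.iterate_injOn_Iio_minimalPeriod (f := φ) (x := y) (hle.trans_lt hn) hn ?_
  simp only [Equiv.Perm.iterate_eq_pow, hmem, h]

theorem SameCycle.exists_pow_lt_minimalPeriod [Finite α] {x y : α} (h : φ.SameCycle y x) :
    ∃ n < Function.minimalPeriod φ y, (φ ^ n) y = x := by
  obtain ⟨n, hn⟩ := h.exists_nat_pow_eq
  refine ⟨n % Function.minimalPeriod φ y, Nat.mod_lt _ (minimalPeriod_pos y), ?_⟩
  rw [← Equiv.Perm.iterate_eq_pow, Function.iterate_mod_minimalPeriod_eq,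
    Equiv.Perm.iterate_eq_pow, hn]

theorem minimalPeriod_apply_perm (x : α) :
    Function.minimalPeriod φ (φ x) = Function.minimalPeriod φ x := by
  rw [Function.minimalPeriod_eq_minimalPeriod_iff]
  intro n
  rw [Function.IsPeriodicPt, Function.IsPeriodicPt, Function.IsFixedPt, Function.IsFixedPt,
    ← Function.iterate_succ_apply, Function.iterate_succ_apply', φ.injective.eq_iff]

theorem SameCycle.minimalPeriod_eq [Finite α] {x y : α} (h : φ.SameCycle x y) :
    Function.minimalPeriod φ x = Function.minimalPeriod φ y := by
  obtain ⟨n, rfl⟩ := h.exists_nat_pow_eq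
  induction n with
  | zero => simp
  | succ k ih =>
    rw [pow_succ', mul_apply, minimalPeriod_apply_perm]
    exact ih ⟨k, by simp⟩

theorem cycleDist_self [Finite α] (x : α) : φ.cycleDist x x = 0 :=
  cycleDist_eq (by simp) (minimalPeriod_pos x)

theorem cycleDist_apply_apply (x y : α) : φ.cycleDist (φ x) (φ y) = φ.cycleDist x y := by
  unfold cycleDist
  congr 1
  ext n
  rw [Set.mem_ofPred_eq, Set.mem_ofPred_eq, ← mul_apply, ← pow_succ, pow_succ', mul_apply,
    φ.injective.eq_iff]

theorem SameCycle.cycleDist_add_cycleDist [Finite α] {x y : α} (h : φ.SameCycle y x)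
    (hxy : x ≠ y) : φ.cycleDist x y + φ.cycleDist y x = Function.minimalPeriod φ y := by
  obtain ⟨n, hn, hnx⟩ := h.exists_pow_lt_minimalPeriod
  have hn0 : n ≠ 0 := by
    rintro rfl
    exact hxy (by simpa using hnx.symm)
  rw [cycleDist_eq hnx hn, cycleDist_eq (n := Function.minimalPeriod φ y - n) (x := y) (y := x)]
  · omega
  · rw [← hnx, ← mul_apply, ← pow_add, Nat.sub_add_cancel hn.le, pow_minimalPeriod_apply]
  · rw [← h.minimalPeriod_eq]
    omega

theorem resolvent_apply_apply (z : ℂ) (x y : α) :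
    φ.resolvent z (φ x) (φ y) = φ.resolvent z x y := by
  have h : φ.SameCycle (φ y) (φ x) ↔ φ.SameCycle y x :=
    sameCycle_apply_left.trans sameCycle_apply_right
  rw [resolvent, resolvent, cycleDist_apply_apply, minimalPeriod_apply_perm]
  by_cases hyx : φ.SameCycle y x
  · rw [if_pos hyx, if_pos (h.2 hyx)]
  · rw [if_neg hyx, if_neg (mt h.1 hyx)]

theorem one_sub_pow_ne_zero {z : ℂ} (hz : ‖z‖ < 1) {n : ℕ} (hn : 0 < n) : 1 - z ^ n ≠ 0 := by
  intro h
  have h1 : ‖z ^ n‖ < 1 := by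
    rw [norm_pow]
    exact pow_lt_one₀ (norm_nonneg z) hz hn.ne'
  rw [← sub_eq_zero.1 h] at h1
  simp at h1

/-- Entrywise form of `(1 - zφ)⁻¹ = zφ(1 - zφ)⁻¹ + 1`. Off the diagonal, stepping back along the
cycle lowers the distance by one. -/
theorem resolvent_eq [Finite α] [DecidableEq α] {z : ℂ} (hz : ‖z‖ < 1) (x y : α) :
    φ.resolvent z x y = z * φ.resolvent z (φ⁻¹ x) y + if x = y then 1 else 0 := by
  have hL := minimalPeriod_pos (φ := φ) y
  have h0 := one_sub_pow_ne_zero hz hL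
  have hinv : φ.SameCycle y (φ⁻¹ x) ↔ φ.SameCycle y x := by
    rw [← sameCycle_apply_right (f := φ), ← mul_apply, mul_inv_cancel, one_apply]
  unfold resolvent
  by_cases h : φ.SameCycle y x
  · rw [if_pos h, if_pos (hinv.2 h)]
    split_ifs with hxy
    · subst hxy
      -- The predecessor of the starting point is a full turn away, less one step. The identity
      -- becomes `1 / (1 - w) = w / (1 - w) + 1` with `w = z ^ L`, where `L` is the period.
      have hd : φ.cycleDist (φ⁻¹ x) x = Function.minimalPeriod φ x - 1 := by
        refine cycleDist_eq ?_ (by omega)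
        apply φ.injective
        rw [← mul_apply, ← pow_succ', Nat.sub_add_cancel hL, pow_minimalPeriod_apply]
        simp
      rw [cycleDist_self, hd]
      field_simp
      rw [← pow_succ', Nat.sub_add_cancel hL]
      ring
    · obtain ⟨n, hn, hnx⟩ := h.exists_pow_lt_minimalPeriod
      obtain _ | n := n
      · exact absurd (by simpa using hnx.symm) hxy
      have hd : φ.cycleDist (φ⁻¹ x) y = n := by
        refine cycleDist_eq ?_ (by omega)
        rw [← hnx, pow_succ', mul_apply]
        simp
      rw [cycleDist_eq hnx hn, hd, pow_succ]
      ring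
  · have hxy : x ≠ y := by
      rintro rfl
      exact h (SameCycle.refl _ _)
    simp [h, hxy]

open ComplexConjugate in
/-- The matrix entries of `(1 - z φ)⁻¹ ((1 - z φ)⁻¹)*`. -/
theorem sum_resolvent_mul_conj [Fintype α] [DecidableEq α] {z : ℂ} (hz : ‖z‖ < 1) (x y : α) :
    (1 - (‖z‖ : ℂ) ^ 2) * ∑ e, φ.resolvent z x e * conj (φ.resolvent z y e) =
      φ.resolvent z x y + conj (φ.resolvent z y x) - if x = y then 1 else 0 := by
  -- The resolvent commutes with `φ`, so a shift of both rows is undone by reindexing the columns.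
  have hinv : ∑ e, φ.resolvent z (φ⁻¹ x) e * conj (φ.resolvent z (φ⁻¹ y) e) =
      ∑ e, φ.resolvent z x e * conj (φ.resolvent z y e) := by
    rw [← Equiv.sum_comp φ (fun e => φ.resolvent z x e * conj (φ.resolvent z y e))]
    refine Finset.sum_congr rfl fun e _ => ?_
    rw [← resolvent_apply_apply z (φ⁻¹ x) e, ← resolvent_apply_apply z (φ⁻¹ y) e]
    simp
  have hrec : ∑ e, φ.resolvent z x e * conj (φ.resolvent z y e) =
      z * conj z * ∑ e, φ.resolvent z (φ⁻¹ x) e * conj (φ.resolvent z (φ⁻¹ y) e) +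
        z * φ.resolvent z (φ⁻¹ x) y + conj z * conj (φ.resolvent z (φ⁻¹ y) x) +
        if x = y then 1 else 0 := by
    calc
      _ = ∑ e, (z * conj z * (φ.resolvent z (φ⁻¹ x) e * conj (φ.resolvent z (φ⁻¹ y) e)) +
          (if y = e then z * φ.resolvent z (φ⁻¹ x) e else 0) +
          (if x = e then conj z * conj (φ.resolvent z (φ⁻¹ y) e) else 0) +
          if x = e then (if y = e then 1 else 0) else 0) := by
        refine Finset.sum_congr rfl fun e _ => ?_
        rw [resolvent_eq hz x e, resolvent_eq hz y e]
        split_ifs <;> simp <;> ring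
      _ = _ := by
        simp only [Finset.sum_add_distrib, Finset.sum_ite_eq, Finset.mem_univ, if_true,
          ← Finset.mul_sum, @eq_comm α y x]
  rw [hinv, Complex.mul_conj'] at hrec
  -- The recursion, read backwards, removes the shifted rows from the two mixed terms of `hrec`.
  have h1 := resolvent_eq (φ := φ) hz x y
  have h2 := congrArg conj (resolvent_eq (φ := φ) hz y x)
  have h3 : conj (if y = x then (1 : ℂ) else 0) = if x = y then 1 else 0 := by
    simp only [@eq_comm α y x]
    split_ifs <;> simp
  rw [map_add, map_mul, h3] at h2
  linear_combination hrec - h1 - h2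

open ComplexConjugate in
-- With `w = z ^ L` this is `1 / (1 - w) + 1 / (1 - w̄) - 1 = (1 - |w|²) / |1 - w|²`.
theorem resolvent_self_add_conj [Finite α] {z : ℂ} (hz : ‖z‖ < 1) (x : α) :
    φ.resolvent z x x + conj (φ.resolvent z x x) - 1 =
      (1 - (‖z‖ : ℂ) ^ (2 * Function.minimalPeriod φ x)) /
        (‖1 - z ^ Function.minimalPeriod φ x‖ : ℂ) ^ 2 := by
  have h0 := one_sub_pow_ne_zero hz (minimalPeriod_pos (φ := φ) x)
  have h0' := (map_ne_zero (starRingEnd ℂ)).2 h0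
  rw [pow_mul, ← Complex.mul_conj', ← Complex.mul_conj', resolvent,
    if_pos (SameCycle.refl _ _), cycleDist_self]
  simp only [map_div₀, map_sub, map_one, map_pow] at h0' ⊢
  field_simp
  ring

open ComplexConjugate in
theorem SameCycle.resolvent_add_conj [Finite α] {z : ℂ} (hz : ‖z‖ < 1) {x y : α}
    (h : φ.SameCycle y x) (hxy : x ≠ y) :
    φ.resolvent z x y + conj (φ.resolvent z y x) =
      1 / (‖1 - z ^ Function.minimalPeriod φ y‖ : ℂ) ^ 2 *
        (z ^ φ.cycleDist x y * (1 - (‖z‖ : ℂ) ^ (2 * φ.cycleDist y x)) +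
          conj z ^ φ.cycleDist y x * (1 - (‖z‖ : ℂ) ^ (2 * φ.cycleDist x y))) := by
  have h0 := one_sub_pow_ne_zero hz (minimalPeriod_pos (φ := φ) y)
  have h0' := (map_ne_zero (starRingEnd ℂ)).2 h0
  rw [pow_mul, pow_mul, ← Complex.mul_conj', ← Complex.mul_conj', resolvent, resolvent,
    if_pos h, if_pos h.symm, ← h.minimalPeriod_eq]
  -- Writing the period as the sum of the two distances makes the claim a polynomial identity in `z`
  -- and its conjugate.
  rw [← h.cycleDist_add_cycleDist hxy] at h0 h0' ⊢
  simp only [map_div₀, map_sub, map_one, map_pow] at h0' ⊢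
  field_simp
  ring

theorem resolvent_of_not_sameCycle (z : ℂ) {x y : α} (h : ¬ φ.SameCycle y x) :
    φ.resolvent z x y = 0 :=
  if_neg h

end CycleDist

end Equiv.Perm

/-! ### Counting arcs on the faces -/

namespace RotationSystem

variable {V : Type*} {G : SimpleGraph V} (R : RotationSystem G)

theorem coverInv_coverInv (g : CoverArc G) : R.coverInv (R.coverInv g) = g :=
  R.coverInv.left_inv g

theorem coverInv_ne (g : CoverArc G) : R.coverInv g ≠ g := fun h =>
  g.1.symm_ne (congrArg Prod.fst h)

theorem facial_inv_apply (g : CoverArc G) :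
    R.facial⁻¹ g = R.coverRot⁻¹ (R.coverInv g) := by
  have : R.coverInv⁻¹ = R.coverInv := rfl
  rw [facial, mul_inv_rev, this, Equiv.Perm.mul_apply]

theorem coverRot_inv_apply (g : CoverArc G) :
    R.coverRot⁻¹ g = R.facial⁻¹ (R.coverInv g) := by
  rw [facial_inv_apply, coverInv_coverInv]

/-- The two arcs can agree in `G` only if the rotation fixes `g`; then they still lie on opposite
sheets, by the `+ 1` in `chiral`. -/
theorem chiral_ne_facial (g : CoverArc G) : R.chiral g ≠ R.facial g := by
  intro h
  have h1 := congrArg Prod.fst h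
  have h2 := congrArg Prod.snd h
  have h3 : g.1 = (R.coverRot g).1 := SimpleGraph.Dart.symm_involutive.injective h1
  change g.2 - R.twist g.1 + 1 = g.2 - R.twist (R.coverRot g).1 at h2
  rw [← h3] at h2
  simp at h2

theorem chiral_ne (g : CoverArc G) : R.chiral g ≠ g := fun h =>
  g.1.symm_ne (congrArg Prod.fst h)

theorem facial_pow_chiral_facial_pow (n : ℕ) (g : CoverArc G) :
    (R.facial ^ n) (R.chiral ((R.facial ^ n) g)) = R.chiral g := by
  induction n with
  | zero => simp
  | succ n ih =>
    rw [pow_succ', Equiv.Perm.mul_apply, Equiv.Perm.mul_apply, ← Equiv.Perm.mul_apply, ← pow_succ',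
      pow_succ, Equiv.Perm.mul_apply, facial_chiral_facial, ih]

/-- No facial walk of the double covering is its own reverse on the opposite sheet. -/
theorem not_sameCycle_chiral [Finite (CoverArc G)] (g : CoverArc G) :
    ¬ R.facial.SameCycle g (R.chiral g) := by
  intro h
  obtain ⟨n, hn⟩ := h.exists_nat_pow_eq
  -- Look at the midpoint `h` of the walk from `g` to its reverse: `chiral h` is `h` for even length
  -- and `facial h` for odd length, both impossible.
  obtain ⟨m, rfl | rfl⟩ := Nat.even_or_odd' n
  · have h1 := R.facial_pow_chiral_facial_pow m g
    rw [← hn, two_mul, pow_add, Equiv.Perm.mul_apply, EmbeddingLike.apply_eq_iff_eq] at h1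
    exact R.chiral_ne _ h1
  · have h1 := R.facial_pow_chiral_facial_pow m g
    rw [← hn, two_mul, add_assoc, pow_add, Equiv.Perm.mul_apply,
      EmbeddingLike.apply_eq_iff_eq, pow_succ', Equiv.Perm.mul_apply] at h1
    exact R.chiral_ne_facial _ h1

open Classical in
theorem card_sameCycle [Fintype V] [DecidableRel G.Adj] (g : CoverArc G) :
    (Finset.univ.filter fun h => R.facial.SameCycle g h).card =
      Function.minimalPeriod R.facial g := by
  have himg : (Finset.univ.filter fun h => R.facial.SameCycle g h) =
      (Finset.range (Function.minimalPeriod R.facial g)).image fun n => (R.facial ^ n) g := by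
    ext h
    simp only [Finset.mem_filter, Finset.mem_univ, true_and, Finset.mem_image, Finset.mem_range]
    constructor
    · exact fun H => H.exists_pow_lt_minimalPeriod
    · rintro ⟨n, -, rfl⟩
      exact ⟨n, by simp⟩
  rw [himg, Finset.card_image_of_injOn, Finset.card_range]
  intro i hi j hj hij
  refine Function.iterate_injOn_Iio_minimalPeriod (f := R.facial) (x := g)
    (by simpa using hi) (by simpa using hj) ?_
  simpa only [Equiv.Perm.iterate_eq_pow] using hij

open Classical in
-- The two walks representing a face are disjoint by `not_sameCycle_chiral` and have the same
-- length. The resulting factor 2 cancels the half in the comfortability.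
theorem card_faceOf_eq [Fintype V] [DecidableRel G.Adj] (f : R.Face) :
    (Finset.univ.filter fun g => R.faceOf g = f).card = 2 * R.faceLength f := by
  obtain ⟨g, rfl⟩ : ∃ g, R.faceOf g = f := Quotient.exists_rep f
  have hu : (Finset.univ.filter fun h => R.faceOf h = R.faceOf g) =
      (Finset.univ.filter fun h => R.facial.SameCycle g h) ∪
        (Finset.univ.filter fun h => R.facial.SameCycle (R.chiral g) h) := by
    ext h
    simp only [Finset.mem_filter, Finset.mem_univ, true_and, Finset.mem_union]
    refine (Quotient.eq (r := R.faceSetoid)).trans ?_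
    refine or_congr Equiv.Perm.sameCycle_comm Equiv.Perm.sameCycle_comm
  have hd : Disjoint (Finset.univ.filter fun h => R.facial.SameCycle g h)
      (Finset.univ.filter fun h => R.facial.SameCycle (R.chiral g) h) := by
    refine Finset.disjoint_filter.2 fun h _ h1 h2 => ?_
    exact R.not_sameCycle_chiral g (h1.trans h2.symm)
  rw [hu, Finset.card_union_of_disjoint hd, card_sameCycle, card_sameCycle, minimalPeriod_chiral,
    two_mul]
  rfl

/-- Summing a function of the face over all arcs of the double covering. -/
theorem sum_faceOf [Fintype V] [DecidableEq V] [DecidableRel G.Adj] (w : R.Face → ℂ) :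
    ∑ g : CoverArc G, w (R.faceOf g) = 2 * ∑ f : R.Face, (R.faceLength f : ℂ) * w f := by
  classical
  rw [← Finset.sum_fiberwise (s := Finset.univ) (g := R.faceOf), Finset.mul_sum]
  refine Finset.sum_congr rfl fun f _ => ?_
  have hc : ∑ g with R.faceOf g = f, w (R.faceOf g) = ∑ g with R.faceOf g = f, w f :=
    Finset.sum_congr rfl fun g hg => by rw [(Finset.mem_filter.1 hg).2]
  have hcard := R.card_faceOf_eq f
  rw [hc, Finset.sum_const, nsmul_eq_mul]
  rw [show (Finset.univ.filter fun g => R.faceOf g = f).card = 2 * R.faceLength f by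
    convert hcard]
  push_cast
  ring

/-- Summing over the self-intersections of all faces. -/
theorem sum_selfIntersections [Fintype V] [DecidableEq V] [DecidableRel G.Adj]
    (w : R.Face → CoverArc G → ℂ) (v : CoverArc G → ℂ)
    (h1 : ∀ g, R.facial.SameCycle g (R.coverInv g) → v g = w (R.faceOf g) g)
    (h0 : ∀ g, ¬ R.facial.SameCycle g (R.coverInv g) → v g = 0) :
    ∑ g : CoverArc G, v g = ∑ f : R.Face, ∑ g ∈ R.selfIntersections f, w f g := by
  classical
  rw [← Finset.sum_fiberwise (s := Finset.univ) (g := R.faceOf)]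
  refine Finset.sum_congr rfl fun f _ => ?_
  symm
  calc
    _ = ∑ g ∈ R.selfIntersections f, v g := by
      refine Finset.sum_congr rfl fun g hg => ?_
      simp only [selfIntersections, Finset.mem_filter, Finset.mem_univ, true_and] at hg
      rw [h1 g hg.2, hg.1]
    _ = _ := by
      refine Finset.sum_subset ?_ ?_
      · intro g hg
        simp only [selfIntersections, Finset.mem_filter, Finset.mem_univ, true_and] at hg ⊢
        exact hg.1
      · intro g hg hg'
        simp only [selfIntersections, Finset.mem_filter, Finset.mem_univ, true_and] at hg hg'
        exact h0 g fun h => hg' ⟨hg, h⟩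

end RotationSystem

/-! ### Algebra of the unitary coin -/

section UnitaryCoin

open ComplexConjugate

variable {C : Matrix (Fin 2) (Fin 2) ℂ}

theorem coin_col_zero (hC : C ∈ Matrix.unitaryGroup (Fin 2) ℂ) :
    conj (C 0 0) * C 0 0 + conj (C 1 0) * C 1 0 = 1 := by
  have h := congrFun (congrFun (Matrix.mem_unitaryGroup_iff'.1 hC) 0) 0
  simpa [Matrix.mul_apply, Fin.sum_univ_two] using h

theorem coin_col_one (hC : C ∈ Matrix.unitaryGroup (Fin 2) ℂ) :
    conj (C 0 1) * C 0 1 + conj (C 1 1) * C 1 1 = 1 := by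
  have h := congrFun (congrFun (Matrix.mem_unitaryGroup_iff'.1 hC) 1) 1
  simpa [Matrix.mul_apply, Fin.sum_univ_two] using h

theorem coin_col_orthogonal (hC : C ∈ Matrix.unitaryGroup (Fin 2) ℂ) :
    conj (C 0 1) * C 0 0 + conj (C 1 1) * C 1 0 = 0 := by
  have h := congrFun (congrFun (Matrix.mem_unitaryGroup_iff'.1 hC) 1) 0
  simpa [Matrix.mul_apply, Fin.sum_univ_two] using h

theorem coin_row_zero (hC : C ∈ Matrix.unitaryGroup (Fin 2) ℂ) :
    C 0 0 * conj (C 0 0) + C 0 1 * conj (C 0 1) = 1 := by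
  have h := congrFun (congrFun (Matrix.mem_unitaryGroup_iff.1 hC) 0) 0
  simpa [Matrix.mul_apply, Fin.sum_univ_two] using h

theorem coin_isometry (hC : C ∈ Matrix.unitaryGroup (Fin 2) ℂ)
    (x y : ℂ) :
    ‖C 0 0 * x + C 0 1 * y‖ ^ 2 + ‖C 1 0 * x + C 1 1 * y‖ ^ 2 = ‖x‖ ^ 2 + ‖y‖ ^ 2 := by
  have h0 := coin_col_zero hC
  have h1 := coin_col_one hC
  have h2 := coin_col_orthogonal hC
  have h3 := congrArg conj h2
  apply Complex.ofReal_injective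
  push_cast
  simp only [← Complex.mul_conj', map_add, map_mul, Complex.conj_conj, map_zero] at h3 ⊢
  linear_combination (x * conj x) * h0 + (y * conj y) * h1 + (x * conj y) * h2 + (y * conj x) * h3

theorem coin_norm_row_zero (hC : C ∈ Matrix.unitaryGroup (Fin 2) ℂ) :
    ‖C 0 0‖ ^ 2 + ‖C 0 1‖ ^ 2 = 1 := by
  apply Complex.ofReal_injective
  push_cast
  rw [← Complex.mul_conj', ← Complex.mul_conj']
  exact coin_row_zero hC

theorem norm_neg_det (hC : C ∈ Matrix.unitaryGroup (Fin 2) ℂ) : ‖-C.det‖ = 1 := by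
  rw [norm_neg]
  exact CStarRing.norm_of_mem_unitary (Matrix.det_of_mem_unitary hC)

theorem norm_coin_mul_neg_det (hC : C ∈ Matrix.unitaryGroup (Fin 2) ℂ) :
    ‖C 0 0 * -C.det‖ = ‖C 0 0‖ := by
  rw [norm_mul, norm_neg_det hC, mul_one]

theorem norm_coin_zero_zero_lt_one (hC : C ∈ Matrix.unitaryGroup (Fin 2) ℂ)
    (hb : C 0 1 ≠ 0) : ‖C 0 0‖ < 1 := by
  have h := coin_norm_row_zero hC
  have hb' : 0 < ‖C 0 1‖ ^ 2 := by positivity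
  exact (sq_lt_one_iff₀ (norm_nonneg _)).1 (by linarith)

/-- Reality of `d` enters here: `a = det C · conj d` holds for every unitary coin. The identity
cancels the reflection at a bridge. -/
theorem coin_zero_zero_add (hC : C ∈ Matrix.unitaryGroup (Fin 2) ℂ)
    (hd : conj (C 1 1) = C 1 1) : C 0 0 + -C.det * C 1 1 = 0 := by
  have h1 := coin_col_one hC
  have h2 := coin_col_orthogonal hC
  rw [hd] at h1 h2
  rw [Matrix.det_fin_two]
  linear_combination C 0 1 * h2 - C 0 0 * h1

theorem coin_zero_one_mul_add (hC : C ∈ Matrix.unitaryGroup (Fin 2) ℂ)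
    (hd : conj (C 1 1) = C 1 1) : C 0 1 * C 1 0 + -C.det * C 1 1 ^ 2 = -C.det := by
  have h1 := coin_col_one hC
  have h2 := coin_col_orthogonal hC
  rw [hd] at h1 h2
  rw [Matrix.det_fin_two]
  linear_combination (C 0 1 * C 1 1) * h2 - (C 0 0 * C 1 1) * h1

end UnitaryCoin

namespace RotationSystem

open ComplexConjugate

variable {V : Type*} {G : SimpleGraph V} (R : RotationSystem G)
  (C : Matrix (Fin 2) (Fin 2) ℂ)

/-! ### Convergence by loss of energy -/

section Decay

theorem step_sub (ψ φ : WalkArc G → ℂ) : R.step C (ψ - φ) = R.step C ψ - R.step C φ := by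
  funext x
  rcases x with g | g | g | ⟨g, j⟩ | ⟨g, _ | j⟩ <;> simp [step] <;> ring

theorem iterate_step_sub (ψ φ : WalkArc G → ℂ) (t : ℕ) :
    (R.step C)^[t] (ψ - φ) = (R.step C)^[t] ψ - (R.step C)^[t] φ := by
  induction t with
  | zero => rfl
  | succ t ih => rw [Function.iterate_succ_apply', Function.iterate_succ_apply',
      Function.iterate_succ_apply', ih, step_sub]

/-- The squared norm of a state on the internal graph. -/
noncomputable def internalEnergy [Fintype V] [DecidableEq V] [DecidableRel G.Adj]
    (ψ : WalkArc G → ℂ) : ℝ :=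
  ∑ g : CoverArc G, (‖ψ (.quayMinus g)‖ ^ 2 + ‖ψ (.quayPlus g)‖ ^ 2 + ‖ψ (.bridge g)‖ ^ 2)

/-- A state without inflow loses in each step the energy that is sent out into the tails. -/
theorem internalEnergy_step [Fintype V] [DecidableEq V] [DecidableRel G.Adj]
    {C : Matrix (Fin 2) (Fin 2) ℂ} (hC : C ∈ Matrix.unitaryGroup (Fin 2) ℂ)
    (ψ : WalkArc G → ℂ) (h0 : ∀ g j, ψ (.tailIn g j) = 0) :
    internalEnergy (R.step C ψ) + ‖C 0 1‖ ^ 2 * ∑ g, ‖ψ (.quayMinus g)‖ ^ 2 =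
      internalEnergy ψ := by
  have hp : ∑ g, ‖ψ (.quayPlus (R.coverRot⁻¹ g))‖ ^ 2 = ∑ g, ‖ψ (.quayPlus g)‖ ^ 2 :=
    Equiv.sum_comp R.coverRot⁻¹ fun g => ‖ψ (.quayPlus g)‖ ^ 2
  have hβ : ∑ g, ‖R.step C ψ (.bridge (R.coverInv g))‖ ^ 2 = ∑ g, ‖R.step C ψ (.bridge g)‖ ^ 2 :=
    Equiv.sum_comp R.coverInv fun g => ‖R.step C ψ (.bridge g)‖ ^ 2
  -- The arcs leaving the vertex `g` are `ξ_g⁻` and the bridge to the inverse of `g`; the twist sign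
  -- does not affect norms.
  have hmp : ∀ g, ‖R.step C ψ (.quayMinus g)‖ ^ 2 + ‖R.step C ψ (.bridge (R.coverInv g))‖ ^ 2 =
      ‖ψ (.quayPlus (R.coverRot⁻¹ g))‖ ^ 2 + ‖ψ (.bridge g)‖ ^ 2 := by
    intro g
    rw [← coin_isometry hC (ψ (.quayPlus (R.coverRot⁻¹ g))) (ψ (.bridge g))]
    simp [step, coverInv_coverInv]
  have hq : ∀ g, ‖R.step C ψ (.quayPlus g)‖ ^ 2 + ‖C 0 1‖ ^ 2 * ‖ψ (.quayMinus g)‖ ^ 2 =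
      ‖ψ (.quayMinus g)‖ ^ 2 := by
    intro g
    have h := coin_norm_row_zero hC
    simp only [step, h0, mul_zero, add_zero, norm_mul, mul_pow]
    rw [← add_mul, h, one_mul]
  have hmp' := Finset.sum_congr rfl fun g (_ : g ∈ Finset.univ) => hmp g
  have hq' := Finset.sum_congr rfl fun g (_ : g ∈ Finset.univ) => hq g
  rw [Finset.sum_add_distrib, Finset.sum_add_distrib, hp, hβ] at hmp'
  rw [Finset.sum_add_distrib, ← Finset.mul_sum] at hq'
  simp only [internalEnergy, Finset.sum_add_distrib]
  linarith

theorem iterate_step_tailIn (ψ : WalkArc G → ℂ) (t : ℕ) (g : CoverArc G) (j : ℕ) :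
    (R.step C)^[t] ψ (.tailIn g j) = ψ (.tailIn g (j + t)) := by
  induction t generalizing j with
  | zero => rfl
  | succ t ih =>
    rw [Function.iterate_succ_apply']
    exact (ih (j + 1)).trans (by rw [add_right_comm, add_assoc])

open Filter Topology in
/-- A state without inflow decays on every arc. -/
theorem tendsto_iterate_step_zero [Fintype V] [DecidableEq V] [DecidableRel G.Adj]
    {C : Matrix (Fin 2) (Fin 2) ℂ} (hC : C ∈ Matrix.unitaryGroup (Fin 2) ℂ) (hb : C 0 1 ≠ 0)
    (ψ : WalkArc G → ℂ) (h0 : ∀ g j, ψ (.tailIn g j) = 0) (x : WalkArc G) :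
    Tendsto (fun t : ℕ => (R.step C)^[t] ψ x) atTop (𝓝 0) := by
  have h0t : ∀ t g j, (R.step C)^[t] ψ (.tailIn g j) = 0 := fun t g j => by
    rw [iterate_step_tailIn, h0]
  have hE : ∀ t, internalEnergy ((R.step C)^[t + 1] ψ) +
      ‖C 0 1‖ ^ 2 * ∑ g, ‖(R.step C)^[t] ψ (.quayMinus g)‖ ^ 2 =
        internalEnergy ((R.step C)^[t] ψ) := fun t => by
    rw [Function.iterate_succ_apply']
    exact R.internalEnergy_step hC _ (h0t t)
  have hanti : Antitone fun t => internalEnergy ((R.step C)^[t] ψ) := by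
    refine antitone_nat_of_succ_le fun t => ?_
    rw [← hE t]
    exact le_add_of_nonneg_right (by positivity)
  have hbdd : BddBelow (Set.range fun t => internalEnergy ((R.step C)^[t] ψ)) := by
    refine ⟨0, ?_⟩
    rintro _ ⟨t, rfl⟩
    exact Finset.sum_nonneg fun g _ => by positivity
  -- The energy converges, so the loss per step, `|b|² ∑ |ψ(ξ_g⁻)|²`, tends to zero.
  have hlim := tendsto_atTop_ciInf hanti hbdd
  have hdiff := hlim.sub (hlim.comp (tendsto_add_atTop_nat 1))
  rw [sub_self] at hdiff
  have hb2 : 0 < ‖C 0 1‖ ^ 2 := by positivity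
  have hm : ∀ g, Tendsto (fun t => (R.step C)^[t] ψ (.quayMinus g)) atTop (𝓝 0) := by
    intro g
    rw [tendsto_zero_iff_norm_tendsto_zero]
    have hsq : Tendsto (fun t => ‖(R.step C)^[t] ψ (.quayMinus g)‖ ^ 2) atTop (𝓝 0) := by
      have hdiff' := hdiff.div_const (‖C 0 1‖ ^ 2)
      rw [zero_div] at hdiff'
      refine squeeze_zero (fun t => by positivity) (fun t => ?_) hdiff'
      rw [le_div_iff₀ hb2, Function.comp_apply, ← hE t, add_sub_cancel_left, mul_comm]
      refine mul_le_mul_of_nonneg_left ?_ hb2.le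
      exact Finset.single_le_sum (f := fun g => ‖(R.step C)^[t] ψ (.quayMinus g)‖ ^ 2)
        (fun g _ => by positivity) (Finset.mem_univ g)
    have hs := hsq.sqrt
    simpa [Real.sqrt_sq (norm_nonneg _)] using hs
  have hp : ∀ g, Tendsto (fun t => (R.step C)^[t] ψ (.quayPlus g)) atTop (𝓝 0) := by
    intro g
    rw [← tendsto_add_atTop_iff_nat 1]
    simp only [Function.iterate_succ_apply', step, h0t, mul_zero, add_zero]
    simpa using (hm g).const_mul (C 0 0)
  have hβ : ∀ g, Tendsto (fun t => (R.step C)^[t] ψ (.bridge g)) atTop (𝓝 0) := by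
    intro g
    -- The coin equation for `ξ_g⁻` is solved for the bridge amplitude, as `b ≠ 0`.
    have h1 := ((tendsto_add_atTop_iff_nat 1).2 (hm g)).sub
      ((hp (R.coverRot⁻¹ g)).const_mul (C 0 0))
    have h2 := h1.const_mul (C 0 1)⁻¹
    simpa [Function.iterate_succ_apply', step, hb] using h2
  rcases x with g | g | g | ⟨g, j⟩ | ⟨g, j⟩
  · exact hm g
  · exact hp g
  · exact hβ g
  · simp [h0t]
  · induction j with
    | zero =>
      rw [← tendsto_add_atTop_iff_nat 1]
      simp only [Function.iterate_succ_apply', step, h0t, mul_zero, add_zero]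
      simpa using (hm g).const_mul (C 1 0)
    | succ j ih =>
      rw [← tendsto_add_atTop_iff_nat 1]
      simpa only [Function.iterate_succ_apply', step] using ih

/-- A fixed point of the walk with the right inflow is the stationary state. -/
theorem isStationaryState_of_step_eq [Fintype V] [DecidableEq V] [DecidableRel G.Adj]
    {C : Matrix (Fin 2) (Fin 2) ℂ} (hC : C ∈ Matrix.unitaryGroup (Fin 2) ℂ) (hb : C 0 1 ≠ 0)
    {α : CoverArc G → ℂ} {ψ : WalkArc G → ℂ} (hψ : R.step C ψ = ψ)
    (hα : ∀ g j, ψ (.tailIn g j) = α g) : R.IsStationaryState C α ψ := by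
  intro x
  have h := R.tendsto_iterate_step_zero hC hb (initialState α - ψ)
    (fun g j => by simp [initialState, hα]) x
  have hfix : ∀ t, (R.step C)^[t] ψ = ψ := Function.iterate_fixed hψ
  simp only [iterate_step_sub, hfix, Pi.sub_apply] at h
  simpa using h.add_const (ψ x)

end Decay

/-! ### The explicit stationary state -/

section Stationary

/-- The sign of the sheet on which an arc of the double covering ends. -/
noncomputable def sheetSign (g : CoverArc G) : ℂ :=
  (-1) ^ g.2.val

theorem sheetSign_mul_self (g : CoverArc G) : sheetSign g * sheetSign g = 1 := by
  rw [sheetSign, ← mul_pow]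
  simp

theorem norm_sheetSign (g : CoverArc G) : ‖sheetSign g‖ = 1 := by
  simp [sheetSign]

/-- An arc changes the sheet by its twist, so the twist sign is the quotient of the sheet signs at
its ends. -/
theorem twist_mul_sheetSign_coverInv (g : CoverArc G) :
    (-1) ^ (R.twist g.1).val * sheetSign (R.coverInv g) = sheetSign g := by
  have h : ∀ t k : ZMod 2, Even (t.val + (k - t).val + k.val) := by decide
  have h1 := (h (R.twist g.1) g.2).neg_one_pow (α := ℂ)
  rw [pow_add, pow_add] at h1
  have h2 := sheetSign_mul_self g
  rw [sheetSign] at h2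
  change (-1) ^ (R.twist g.1).val * (-1) ^ (g.2 - R.twist g.1).val = (-1 : ℂ) ^ g.2.val
  linear_combination ((-1 : ℂ) ^ g.2.val) * h1 -
    (-1) ^ (R.twist g.1).val * (-1) ^ (g.2 - R.twist g.1).val * h2

theorem sheetSign_coverRot_inv (g : CoverArc G) :
    sheetSign (R.coverRot⁻¹ g) = sheetSign g :=
  rfl

/-- The stationary state for the unit inflow from the tail of `e`. -/
noncomputable def stationaryState [DecidableEq V] (e : CoverArc G) : WalkArc G → ℂ
  | .quayMinus g => -C.det * C 0 1 * (sheetSign g * sheetSign e *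
      R.facial.resolvent (C 0 0 * -C.det) (R.facial⁻¹ g) e)
  | .quayPlus g => C 0 1 * (sheetSign g * sheetSign e *
      R.facial.resolvent (C 0 0 * -C.det) g e)
  | .bridge g => -C.det * (sheetSign g * sheetSign e *
      (R.facial.resolvent (C 0 0 * -C.det) (R.facial⁻¹ g) e +
        C 1 1 * R.facial.resolvent (C 0 0 * -C.det) (R.facial⁻¹ (R.coverInv g)) e))
  | .tailIn g _ => Pi.single (M := fun _ => ℂ) e 1 g
  | .tailOut g _ => C 1 0 * (-C.det * C 0 1 * (sheetSign g * sheetSign e *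
      R.facial.resolvent (C 0 0 * -C.det) (R.facial⁻¹ g) e)) +
      C 1 1 * Pi.single (M := fun _ => ℂ) e 1 g

theorem step_stationaryState [Fintype V] [DecidableEq V] [DecidableRel G.Adj]
    {C : Matrix (Fin 2) (Fin 2) ℂ} (hC : C ∈ Matrix.unitaryGroup (Fin 2) ℂ) (hb : C 0 1 ≠ 0)
    (hd : conj (C 1 1) = C 1 1) (e : CoverArc G) :
    R.step C (R.stationaryState C e) = R.stationaryState C e := by
  have hz : ‖C 0 0 * -C.det‖ < 1 := by
    rw [norm_coin_mul_neg_det hC]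
    exact norm_coin_zero_zero_lt_one hC hb
  have h1 := coin_zero_zero_add hC hd
  have h2 := coin_zero_one_mul_add hC hd
  funext x
  rcases x with g | g | g | ⟨g, j⟩ | ⟨g, _ | j⟩
  · simp only [step, stationaryState, sheetSign_coverRot_inv]
    rw [coverRot_inv_apply]
    linear_combination (C 0 1 * sheetSign g * sheetSign e *
      R.facial.resolvent (C 0 0 * -C.det) (R.facial⁻¹ (R.coverInv g)) e) * h1
  · simp only [step, stationaryState]
    -- The tail roots are the only place where the resolvent equation is needed; its Kronecker delta
    -- is the inflow.
    rw [Equiv.Perm.resolvent_eq hz g e]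
    by_cases hge : g = e
    · subst hge
      simp only [Pi.single_eq_same, if_true]
      linear_combination -C 0 1 * sheetSign_mul_self g
    · simp only [Pi.single_eq_of_ne hge, if_neg hge]
      ring
  · simp only [step, stationaryState, sheetSign_coverRot_inv, coverInv_coverInv]
    rw [← R.facial_inv_apply]
    rw [← R.twist_mul_sheetSign_coverInv g]
    linear_combination ((-1) ^ (R.twist g.1).val * sheetSign (R.coverInv g) * sheetSign e *
      R.facial.resolvent (C 0 0 * -C.det) (R.facial⁻¹ g) e) * h2
  · rfl
  · rfl
  · rfl

theorem isStationaryState_stationaryState [Fintype V] [DecidableEq V] [DecidableRel G.Adj]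
    {C : Matrix (Fin 2) (Fin 2) ℂ} (hC : C ∈ Matrix.unitaryGroup (Fin 2) ℂ) (hb : C 0 1 ≠ 0)
    (hd : conj (C 1 1) = C 1 1) (e : CoverArc G) :
    R.IsStationaryState C (Pi.single e 1) (R.stationaryState C e) :=
  R.isStationaryState_of_step_eq hC hb (R.step_stationaryState hC hb hd e) fun _ _ => rfl

end Stationary

end RotationSystem

namespace RotationSystem

open ComplexConjugate

variable {V : Type*} {G : SimpleGraph V} (R : RotationSystem G)

/-! ### Averaging the energy over the tails -/

section Energy

variable [Fintype V] [DecidableEq V] [DecidableRel G.Adj]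

/-- The entries of the real part of `(1 + z φ) (1 - z φ)⁻¹`, for the facial permutation `φ`. -/
noncomputable def poissonKernel (z : ℂ) (g h : CoverArc G) : ℂ :=
  R.facial.resolvent z g h + conj (R.facial.resolvent z h g) - if g = h then 1 else 0

theorem sum_poissonKernel_self {z : ℂ} (hz : ‖z‖ < 1) :
    ∑ g, R.poissonKernel z g g = 2 * ∑ f : R.Face, (R.faceLength f : ℂ) *
      ((1 - (‖z‖ : ℂ) ^ (2 * R.faceLength f)) / (‖1 - z ^ R.faceLength f‖ : ℂ) ^ 2) := by
  rw [← R.sum_faceOf fun f =>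
    (1 - (‖z‖ : ℂ) ^ (2 * R.faceLength f)) / (‖1 - z ^ R.faceLength f‖ : ℂ) ^ 2]
  refine Finset.sum_congr rfl fun g _ => ?_
  rw [poissonKernel, if_pos rfl, Equiv.Perm.resolvent_self_add_conj hz]
  rfl

theorem sum_poissonKernel_coverInv {z : ℂ} (hz : ‖z‖ < 1) :
    ∑ g, R.poissonKernel z (R.coverInv g) g =
      ∑ f : R.Face, 1 / (‖1 - z ^ R.faceLength f‖ : ℂ) ^ 2 *
        ∑ e ∈ R.selfIntersections f,
          (z ^ R.walkDist (R.coverInv e) e *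
              (1 - (‖z‖ : ℂ) ^ (2 * R.walkDist e (R.coverInv e))) +
            conj z ^ R.walkDist e (R.coverInv e) *
              (1 - (‖z‖ : ℂ) ^ (2 * R.walkDist (R.coverInv e) e))) := by
  simp only [Finset.mul_sum]
  refine R.sum_selfIntersections (fun f e => 1 / (‖1 - z ^ R.faceLength f‖ : ℂ) ^ 2 *
    (z ^ R.walkDist (R.coverInv e) e * (1 - (‖z‖ : ℂ) ^ (2 * R.walkDist e (R.coverInv e))) +
      conj z ^ R.walkDist e (R.coverInv e) *
        (1 - (‖z‖ : ℂ) ^ (2 * R.walkDist (R.coverInv e) e)))) _ (fun g h => ?_) (fun g h => ?_)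
  · rw [poissonKernel, if_neg (R.coverInv_ne g), sub_zero,
      h.resolvent_add_conj hz (R.coverInv_ne g)]
    rfl
  · rw [poissonKernel, if_neg (R.coverInv_ne g), Equiv.Perm.resolvent_of_not_sameCycle z h,
      Equiv.Perm.resolvent_of_not_sameCycle z fun h' => h h'.symm]
    simp

variable {C : Matrix (Fin 2) (Fin 2) ℂ}

/-- The factor `|b|²` from the amplitudes equals `1 - |z|²`, as `|ω| = 1`. -/
theorem sum_resolvent_facial_mul_conj (hC : C ∈ Matrix.unitaryGroup (Fin 2) ℂ) (hb : C 0 1 ≠ 0)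
    (g h : CoverArc G) :
    (‖C 0 1‖ : ℂ) ^ 2 * ∑ e, R.facial.resolvent (C 0 0 * -C.det) g e *
        conj (R.facial.resolvent (C 0 0 * -C.det) h e) =
      R.poissonKernel (C 0 0 * -C.det) g h := by
  have hz : ‖C 0 0 * -C.det‖ < 1 := by
    rw [norm_coin_mul_neg_det hC]
    exact norm_coin_zero_zero_lt_one hC hb
  rw [poissonKernel, ← Equiv.Perm.sum_resolvent_mul_conj hz, norm_coin_mul_neg_det hC]
  have h1 : (‖C 0 1‖ : ℂ) ^ 2 = 1 - (‖C 0 0‖ : ℂ) ^ 2 := by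
    rw [eq_sub_iff_add_eq']
    exact_mod_cast coin_norm_row_zero hC
  rw [h1]

theorem sum_resolvent_facial_inv_mul_conj (hC : C ∈ Matrix.unitaryGroup (Fin 2) ℂ)
    (hb : C 0 1 ≠ 0) (g h : CoverArc G) :
    (‖C 0 1‖ : ℂ) ^ 2 * ∑ e, R.facial.resolvent (C 0 0 * -C.det) (R.facial⁻¹ g) e *
        conj (R.facial.resolvent (C 0 0 * -C.det) (R.facial⁻¹ h) e) =
      R.poissonKernel (C 0 0 * -C.det) g h := by
  rw [← R.sum_resolvent_facial_mul_conj hC hb, ← Equiv.sum_comp R.facial fun e =>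
    R.facial.resolvent (C 0 0 * -C.det) g e * conj (R.facial.resolvent (C 0 0 * -C.det) h e)]
  congr 1
  refine Finset.sum_congr rfl fun e _ => ?_
  rw [← Equiv.Perm.resolvent_apply_apply _ (R.facial⁻¹ g) e,
    ← Equiv.Perm.resolvent_apply_apply _ (R.facial⁻¹ h) e]
  simp

theorem sum_norm_sq_quayMinus (hC : C ∈ Matrix.unitaryGroup (Fin 2) ℂ) (hb : C 0 1 ≠ 0)
    (g : CoverArc G) :
    ∑ e, (‖R.stationaryState C e (.quayMinus g)‖ : ℂ) ^ 2 =
      R.poissonKernel (C 0 0 * -C.det) g g := by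
  rw [← R.sum_resolvent_facial_inv_mul_conj hC hb, Finset.mul_sum]
  refine Finset.sum_congr rfl fun e _ => ?_
  rw [Complex.mul_conj', stationaryState]
  simp only [norm_mul, norm_sheetSign, norm_neg_det hC]
  push_cast
  ring

theorem sum_norm_sq_quayPlus (hC : C ∈ Matrix.unitaryGroup (Fin 2) ℂ) (hb : C 0 1 ≠ 0)
    (g : CoverArc G) :
    ∑ e, (‖R.stationaryState C e (.quayPlus g)‖ : ℂ) ^ 2 =
      R.poissonKernel (C 0 0 * -C.det) g g := by
  rw [← R.sum_resolvent_facial_mul_conj hC hb, Finset.mul_sum]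
  refine Finset.sum_congr rfl fun e _ => ?_
  rw [Complex.mul_conj', stationaryState]
  simp only [norm_mul, norm_sheetSign]
  push_cast
  ring

theorem sum_norm_sq_bridge (hC : C ∈ Matrix.unitaryGroup (Fin 2) ℂ) (hb : C 0 1 ≠ 0)
    (hd : conj (C 1 1) = C 1 1) (g : CoverArc G) :
    (‖C 0 1‖ : ℂ) ^ 2 * ∑ e, (‖R.stationaryState C e (.bridge g)‖ : ℂ) ^ 2 =
      R.poissonKernel (C 0 0 * -C.det) g g +
        C 1 1 ^ 2 * R.poissonKernel (C 0 0 * -C.det) (R.coverInv g) (R.coverInv g) +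
        C 1 1 * (R.poissonKernel (C 0 0 * -C.det) g (R.coverInv g) +
          R.poissonKernel (C 0 0 * -C.det) (R.coverInv g) g) := by
  simp only [← R.sum_resolvent_facial_inv_mul_conj hC hb, Finset.mul_sum,
    ← Finset.sum_add_distrib]
  refine Finset.sum_congr rfl fun e _ => ?_
  rw [stationaryState]
  simp only [norm_mul, norm_sheetSign, norm_neg_det hC, one_mul]
  rw [← Complex.mul_conj' (_ + _), map_add, map_mul, hd]
  ring

/-- The quay arcs contribute 2 diagonal sums and the bridges `(1 + d²) / |b|²`; with `d² = 1 - |b|²`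
the total is `(2 + |b|²) / |b|²`. The two cross terms of the bridges have equal sums, which absorbs
the half in front of them. -/
theorem sum_comfortability_stationaryState (hC : C ∈ Matrix.unitaryGroup (Fin 2) ℂ)
    (hb : C 0 1 ≠ 0) (hd : conj (C 1 1) = C 1 1) :
    ((∑ e, comfortability (R.stationaryState C e) : ℝ) : ℂ) =
      (2 + (‖C 0 1‖ : ℂ) ^ 2) / (‖C 0 1‖ : ℂ) ^ 2 *
          (1 / 2 * ∑ g, R.poissonKernel (C 0 0 * -C.det) g g) +
        C 1 1 / (‖C 0 1‖ : ℂ) ^ 2 *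
          ∑ g, R.poissonKernel (C 0 0 * -C.det) (R.coverInv g) g := by
  have hb' : (‖C 0 1‖ : ℂ) ≠ 0 := by simpa using hb
  have hd2 : C 1 1 ^ 2 = 1 - (‖C 0 1‖ : ℂ) ^ 2 := by
    have h := coin_col_one hC
    rw [hd, Complex.conj_mul'] at h
    linear_combination h
  have h1 : ∑ g, R.poissonKernel (C 0 0 * -C.det) (R.coverInv g) (R.coverInv g) =
      ∑ g, R.poissonKernel (C 0 0 * -C.det) g g :=
    Equiv.sum_comp R.coverInv fun g => R.poissonKernel (C 0 0 * -C.det) g g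
  have h2 : ∑ g, R.poissonKernel (C 0 0 * -C.det) g (R.coverInv g) =
      ∑ g, R.poissonKernel (C 0 0 * -C.det) (R.coverInv g) g := by
    rw [← Equiv.sum_comp R.coverInv fun g => R.poissonKernel (C 0 0 * -C.det) g (R.coverInv g)]
    simp only [coverInv_coverInv]
  have hβ := Finset.sum_congr rfl fun g (_ : g ∈ Finset.univ) => R.sum_norm_sq_bridge hC hb hd g
  simp only [Finset.sum_add_distrib, ← Finset.mul_sum, h1, h2, hd2] at hβ
  simp only [comfortability, ← Finset.mul_sum]
  push_cast
  rw [Finset.sum_comm]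
  simp only [Finset.sum_add_distrib, R.sum_norm_sq_quayMinus hC hb, R.sum_norm_sq_quayPlus hC hb]
  generalize C 0 0 * -C.det = z at hβ ⊢
  field_simp
  linear_combination hβ

end Energy

end RotationSystem

theorem theorem7 {V : Type*} [Fintype V] [DecidableEq V] (G : SimpleGraph V) [DecidableRel G.Adj]
    (R : RotationSystem G) (C : Matrix (Fin 2) (Fin 2) ℂ)
    (hC : C ∈ Matrix.unitaryGroup (Fin 2) ℂ)
    (a b d ω : ℂ) (ha : a = C 0 0) (hb : b = C 0 1) (hd : d = C 1 1) (hω : ω = -C.det)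
    (hdreal : d.im = 0) (hb0 : b ≠ 0) :
    ∃ ψ : CoverArc G → WalkArc G → ℂ,
      (∀ e : CoverArc G, R.IsStationaryState C (Pi.single e 1) (ψ e)) ∧
      ((1 / (Fintype.card (CoverArc G) : ℝ) * ∑ e : CoverArc G, comfortability (ψ e) : ℝ) : ℂ) =
        1 / (Fintype.card (CoverArc G) : ℂ) * ((2 + (‖b‖ : ℂ) ^ 2) / (‖b‖ : ℂ) ^ 2) *
          ∑ f : R.Face, (R.faceLength f : ℂ) *
            ((1 - (‖a‖ : ℂ) ^ (2 * R.faceLength f)) /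
              (‖1 - (a * ω) ^ R.faceLength f‖ : ℂ) ^ 2) +
        1 / (Fintype.card (CoverArc G) : ℂ) * (d / (‖b‖ : ℂ) ^ 2) *
          ∑ f : R.Face, 1 / (‖1 - (a * ω) ^ R.faceLength f‖ : ℂ) ^ 2 *
            ∑ e ∈ R.selfIntersections f,
              ((a * ω) ^ R.walkDist (R.coverInv e) e *
                  (1 - (‖a‖ : ℂ) ^ (2 * R.walkDist e (R.coverInv e))) +
                (starRingEnd ℂ (a * ω)) ^ R.walkDist e (R.coverInv e) *
                  (1 - (‖a‖ : ℂ) ^ (2 * R.walkDist (R.coverInv e) e))) := by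
  subst ha hb hd hω
  have hd' : starRingEnd ℂ (C 1 1) = C 1 1 := Complex.conj_eq_iff_im.2 hdreal
  have hz : ‖C 0 0 * -C.det‖ < 1 := by
    rw [norm_coin_mul_neg_det hC]
    exact norm_coin_zero_zero_lt_one hC hb0
  refine ⟨R.stationaryState C, R.isStationaryState_stationaryState hC hb0 hd', ?_⟩
  rw [Complex.ofReal_mul, R.sum_comfortability_stationaryState hC hb0 hd',
    R.sum_poissonKernel_self hz, R.sum_poissonKernel_coverInv hz, norm_coin_mul_neg_det hC]
  push_cast
  ring
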